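/- **Theorem.** Let $K$ be a field of characteristic $0$, let $d\ge 1$ and let $F_d$ be the free metabelian associative algebra over $K$ with free generators $x_1,\dots,x_d$, i.e. the quotient of the free unital associative algebra $K\langle x_1,\dots,x_d\rangle$ by all consequences of the identity $[f,g][h,k]=0$, where $[f,g]=fg-gf$. Let $F_d'$ be its commutator ideal (the two-sided ideal generated by all commutators). It is a module over the polynomial algebra $K[U_d,V_d]=K[u_1,\dots,u_d,v_1,\dots,v_d]$ via $f u_i=x_i f$ and $f v_i=[f,x_i]$ for $f\in F_d'$. Let $F_{d-1}$ be the free metabelian algebra on $x_1,\dots,x_{d-1}$, naturally mapped into $F_d$, and similarly $K[U_{d-1},V_{d-1}]\subset K[U_d,V_d]$. Let $K[U_{d-1},V_{d-1}]_\omega=K[U_{d-1}]\otimes_K\omega(K[V_{d-1}])$, where $\omega$ denotes the augmentation ideal; this is the ideal of $K[U_{d-1},V_{d-1}]$ generated by $v_1,\dots,v_{d-1}$. Let $\delta$ be the derivation of $F_d$ determined by $\delta(x_j)=\sum_{i=1}^d\alpha_{ij}x_i$ $(\alpha_{ij}\in K)$, and assume that $\delta(x_d)=0$, that $\delta$ maps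 $KX_{d-1}=\operatorname{span}_K(x_1,\dots,x_{d-1})$ into itself, and that $\delta$ is nilpotent on $KX_{d-1}$. Let $\delta$ act also as a derivation on $K[U_{d-1},V_{d-1}]$, acting on the $u_j$ and on the $v_j$, $j<d$, with the same coefficients as on the $x_j$, and on $F_{d-1}$ by restriction. For a space $M$ on which $\delta$ acts write $M^\delta=\{m\in M:\delta(m)=0\}$. Let $\pi:K[U_{d-1},V_{d-1}]\to F_d'$ be the $K$-linear map given on monomials by $$\pi(u_{i_1}\cdots u_{i_r}v_{j_1}\cdots v_{j_s})=\sum_{k=1}^{s}[x_d,x_{j_k}]\,v_{j_1}\cdots v_{j_{k-1}}v_{j_{k+1}}\cdots v_{j_s}\,u_{i_1}\cdots u_{i_r}$$ (so $\pi(u_{i_1}\cdots u_{i_r})=0$). Let $\{d_i\mid i\in I\}$ and $\{g_j\mid j\in J\}$ be $K$-vector space bases of $(F_{d-1}')^\delta$ and of $K[U_{d-1},V_{d-1}]_\omega^\delta$, respectively (for instance, homogeneous ones). Then the elements $$d_iu_d^mv_d^n\quad(i\in I,\ m,n\ge0),\qquad \pi(g_j)u_d^mv_d^n\quad(j\in J,\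 m,n\ge 0)$$ form (without repetitions) a $K$-vector space basis of $(F_d')^\delta$. -/

import Mathlib

noncomputable section

namespace FreeMetab

/-! ### The free metabelian associative algebra -/

/-- The metabelian identity `[f, g] [h, k] = 0`, as a relation on the free associative algebra. -/
inductive Rel (K X : Type*) [Field K] : FreeAlgebra K X → FreeAlgebra K X → Prop
  | metabelian (f g h k : FreeAlgebra K X) :
      Rel K X ((f * g - g * f) * (h * k - k * h)) 0

/-- The free metabelian associative algebra over `K` with free generating set `X`: the quotient of
the free unital associative algebra by all the consequences of `[f, g] [h, k] = 0`. -/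
def FreeMet (K X : Type*) [Field K] : Type _ := RingQuot (Rel K X)

instance (K X : Type*) [Field K] : Ring (FreeMet K X) :=
  inferInstanceAs (Ring (RingQuot (Rel K X)))

instance (K X : Type*) [Field K] : Algebra K (FreeMet K X) :=
  inferInstanceAs (Algebra K (RingQuot (Rel K X)))

/-- The quotient map from the free associative algebra. -/
def quotHom (K X : Type*) [Field K] : FreeAlgebra K X →ₐ[K] FreeMet K X :=
  RingQuot.mkAlgHom K (Rel K X)

section Universal

variable {K : Type*} [Field K] {X : Type*}

/-- The free generators. -/
def gen (K : Type*) [Field K] {X : Type*} (j : X) : FreeMet K X :=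
  quotHom K X (FreeAlgebra.ι K j)

theorem quotHom_surjective : Function.Surjective (quotHom K X) :=
  RingQuot.mkAlgHom_surjective K (Rel K X)

theorem metabelian_identity (a b c e : FreeMet K X) :
    (a * b - b * a) * (c * e - e * c) = 0 := by
  obtain ⟨a, rfl⟩ := quotHom_surjective a
  obtain ⟨b, rfl⟩ := quotHom_surjective b
  obtain ⟨c, rfl⟩ := quotHom_surjective c
  obtain ⟨e, rfl⟩ := quotHom_surjective e
  have h : quotHom K X _ = quotHom K X _ := RingQuot.mkAlgHom_rel K (Rel.metabelian a b c e)
  simpa only [map_mul, map_sub, map_zero] using h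

/-- The universal property: a map from `X` to a metabelian algebra extends to a homomorphism. -/
def lift {B : Type*} [Ring B] [Algebra K B]
    (hB : ∀ a b c e : B, (a * b - b * a) * (c * e - e * c) = 0) (f : X → B) :
    FreeMet K X →ₐ[K] B :=
  RingQuot.liftAlgHom K ⟨FreeAlgebra.lift K f, by
    rintro _ _ ⟨a, b, c, e⟩
    simp only [map_mul, map_sub, map_zero, hB]⟩

@[simp] theorem lift_gen {B : Type*} [Ring B] [Algebra K B]
    (hB : ∀ a b c e : B, (a * b - b * a) * (c * e - e * c) = 0) (f : X → B) (j : X) :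
    lift (K := K) hB f (gen K j) = f j :=
  (RingQuot.liftAlgHom_mkAlgHom_apply K _ _ _).trans (by simp)

/-- The homomorphism of free metabelian algebras induced by a map of the generators. -/
def map {Y : Type*} (f : X → Y) : FreeMet K X →ₐ[K] FreeMet K Y :=
  lift metabelian_identity fun j => gen K (f j)

/-! ### Derivations -/

/-- The homomorphism `x_j ↦ x_j + ε a_j` to the dual numbers over the free metabelian algebra. -/
def derivAux (a : X → FreeMet K X) : FreeMet K X →ₐ[K] TrivSqZeroExt (FreeMet K X) (FreeMet K X) :=
  lift (by
    intro p q r s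
    ext
    · simpa using metabelian_identity p.fst q.fst r.fst s.fst
    · have h1 := metabelian_identity p.fst q.fst r.fst s.snd
      have h2 := metabelian_identity p.fst q.fst r.snd s.fst
      have h3 := metabelian_identity p.fst q.snd r.fst s.fst
      have h4 := metabelian_identity p.snd q.fst r.fst s.fst
      simp only [TrivSqZeroExt.snd_mul, TrivSqZeroExt.snd_sub, TrivSqZeroExt.fst_mul,
        TrivSqZeroExt.fst_sub, smul_eq_mul, MulOpposite.smul_eq_mul_unop, MulOpposite.unop_op,
        TrivSqZeroExt.snd_zero]
      calc _ = (p.fst * q.fst - q.fst * p.fst) * (r.fst * s.snd - s.snd * r.fst)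
            + (p.fst * q.fst - q.fst * p.fst) * (r.snd * s.fst - s.fst * r.snd)
            + (p.fst * q.snd - q.snd * p.fst) * (r.fst * s.fst - s.fst * r.fst)
            + (p.snd * q.fst - q.fst * p.snd) * (r.fst * s.fst - s.fst * r.fst) := by
              noncomm_ring
        _ = 0 := by rw [h1, h2, h3, h4]; simp)
    fun j => TrivSqZeroExt.inl (gen K j) + TrivSqZeroExt.inr (a j)

/-- The derivation of the free metabelian algebra which extends the map `x_j ↦ a_j`. -/
def deriv (a : X → FreeMet K X) : FreeMet K X →ₗ[K] FreeMet K X :=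
  (TrivSqZeroExt.sndHom (FreeMet K X) (FreeMet K X)).restrictScalars K ∘ₗ
    (derivAux a).toLinearMap

theorem hom_ext {B : Type*} [Ring B] [Algebra K B] {f g : FreeMet K X →ₐ[K] B}
    (h : ∀ j, f (gen K j) = g (gen K j)) : f = g := by
  have key : f.comp (quotHom K X) = g.comp (quotHom K X) := by
    ext j
    exact h j
  ext x
  obtain ⟨y, rfl⟩ := quotHom_surjective x
  exact DFunLike.congr_fun key y

@[simp] theorem deriv_gen (a : X → FreeMet K X) (j : X) : deriv a (gen K j) = a j := by
  simp [deriv, derivAux]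

theorem derivAux_fst (a : X → FreeMet K X) (f : FreeMet K X) : (derivAux a f).fst = f := by
  have h : (TrivSqZeroExt.fstHom K (FreeMet K X) (FreeMet K X)).comp (derivAux a)
      = AlgHom.id K _ := hom_ext fun j => by simp [derivAux]
  exact DFunLike.congr_fun h f

theorem deriv_mul (a : X → FreeMet K X) (f g : FreeMet K X) :
    deriv a (f * g) = deriv a f * g + f * deriv a g := by
  simp [deriv, derivAux_fst, add_comm]

/-- The linear derivation `δ` of the free metabelian algebra with matrix `α`:
`δ(x_j) = ∑ i, α i j • x_i`. -/
def linDeriv [Fintype X] (α : Matrix X X K) : FreeMet K X →ₗ[K] FreeMet K X :=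
  deriv fun j => ∑ i, α i j • gen K i

/-! ### The commutator ideal -/

variable (K X) in
/-- The commutator ideal `F'`, i.e. the two-sided ideal generated by all the commutators,
as a vector space. -/
def commIdeal : Submodule K (FreeMet K X) :=
  (TwoSidedIdeal.asIdeal
    (TwoSidedIdeal.span {c : FreeMet K X | ∃ f g, c = f * g - g * f})).restrictScalars K

theorem mem_commIdeal {f : FreeMet K X} : f ∈ commIdeal K X ↔
    f ∈ TwoSidedIdeal.span {c : FreeMet K X | ∃ f g, c = f * g - g * f} := by
  simp [commIdeal]

theorem comm_mem (f g : FreeMet K X) : f * g - g * f ∈ commIdeal K X :=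
  mem_commIdeal.2 (TwoSidedIdeal.subset_span ⟨f, g, rfl⟩)

theorem mul_mem_left (f : FreeMet K X) {c : FreeMet K X} (hc : c ∈ commIdeal K X) :
    f * c ∈ commIdeal K X :=
  mem_commIdeal.2 (TwoSidedIdeal.mul_mem_left _ _ _ (mem_commIdeal.1 hc))

theorem mul_mem_right (f : FreeMet K X) {c : FreeMet K X} (hc : c ∈ commIdeal K X) :
    c * f ∈ commIdeal K X :=
  mem_commIdeal.2 (TwoSidedIdeal.mul_mem_right _ _ _ (mem_commIdeal.1 hc))

theorem comm_mul_of_mem (a b : FreeMet K X) {c : FreeMet K X} (hc : c ∈ commIdeal K X) :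
    (a * b - b * a) * c = 0 := by
  replace hc := mem_commIdeal.1 hc
  revert a b
  induction hc using TwoSidedIdeal.span_induction with
  | mem x h =>
    obtain ⟨f, g, rfl⟩ := h
    exact fun a b => metabelian_identity a b f g
  | zero => simp
  | add x y _ _ hx hy => intro a b; rw [mul_add, hx, hy, add_zero]
  | neg x _ hx => intro a b; rw [mul_neg, hx, neg_zero]
  | left_absorb r x _ hx =>
    intro a b
    have h : (a * b - b * a) * (r * x) = r * ((a * b - b * a) * x)
        + ((a * b - b * a) * r - r * (a * b - b * a)) * x := by noncomm_ring
    rw [h, hx, hx]; simp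
  | right_absorb r x _ hx => intro a b; rw [← mul_assoc, hx, zero_mul]

theorem mul_comm_of_mem (a b : FreeMet K X) {c : FreeMet K X} (hc : c ∈ commIdeal K X) :
    c * (a * b - b * a) = 0 := by
  replace hc := mem_commIdeal.1 hc
  revert a b
  induction hc using TwoSidedIdeal.span_induction with
  | mem x h =>
    obtain ⟨f, g, rfl⟩ := h
    exact fun a b => metabelian_identity f g a b
  | zero => simp
  | add x y _ _ hx hy => intro a b; rw [add_mul, hx, hy, add_zero]
  | neg x _ hx => intro a b; rw [neg_mul, hx, neg_zero]
  | left_absorb r x _ hx => intro a b; rw [mul_assoc, hx, mul_zero]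
  | right_absorb r x _ hx =>
    intro a b
    have h : x * r * (a * b - b * a) = x * (a * b - b * a) * r
        + x * (r * (a * b - b * a) - (a * b - b * a) * r) := by noncomm_ring
    rw [h, hx, hx]; simp

/-! ### The action of `K[U, V]` on the commutator ideal -/

/-- The action of `u_i`: left multiplication by `x_i`. -/
def leftOp (i : X) : Module.End K (commIdeal K X) where
  toFun f := ⟨gen K i * f.1, mul_mem_left _ f.2⟩
  map_add' _ _ := Subtype.ext (mul_add _ _ _)
  map_smul' _ _ := Subtype.ext (mul_smul_comm _ _ _)

/-- The action of `v_i`: `f ↦ f ad x_i = [f, x_i] = f x_i - x_i f`. -/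
def adOp (i : X) : Module.End K (commIdeal K X) where
  toFun f := ⟨f.1 * gen K i - gen K i * f.1, comm_mem _ _⟩
  map_add' f g := Subtype.ext (by simp only [Submodule.coe_add]; noncomm_ring)
  map_smul' c f := Subtype.ext (by simp [smul_sub])

theorem leftOp_comm (i j : X) : leftOp (K := K) i * leftOp j = leftOp j * leftOp i := by
  ext f
  have h := comm_mul_of_mem (gen K i) (gen K j) f.2
  rw [sub_mul, sub_eq_zero] at h
  simpa [leftOp, mul_assoc] using h

theorem adOp_comm (i j : X) : adOp (K := K) i * adOp j = adOp j * adOp i := by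
  ext f
  have h1 := comm_mul_of_mem (gen K i) (gen K j) f.2
  have h2 := mul_comm_of_mem (gen K i) (gen K j) f.2
  rw [← sub_eq_zero]
  simp only [adOp, Module.End.mul_apply, LinearMap.coe_mk, AddHom.coe_mk]
  calc _ = (gen K i * gen K j - gen K j * gen K i) * f.1
        - f.1 * (gen K i * gen K j - gen K j * gen K i) := by noncomm_ring
    _ = 0 := by rw [h1, h2, sub_zero]

theorem leftOp_adOp_comm (i j : X) : leftOp (K := K) i * adOp j = adOp j * leftOp i := by
  ext f
  have h1 := comm_mul_of_mem (gen K i) (gen K j) f.2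
  rw [← sub_eq_zero]
  simp only [leftOp, adOp, Module.End.mul_apply, LinearMap.coe_mk, AddHom.coe_mk]
  calc _ = -((gen K i * gen K j - gen K j * gen K i) * f.1) := by noncomm_ring
    _ = 0 := by rw [h1, neg_zero]

end Universal

/-- The algebra homomorphism from a polynomial algebra which sends the variables to given
pairwise commuting operators. -/
def commAeval {K ι M : Type*} [Field K] [AddCommGroup M] [Module K M]
    (a : ι → Module.End K M) (ha : ∀ i j, a i * a j = a j * a i) :
    MvPolynomial ι K →ₐ[K] Module.End K M :=
  letI : CommRing (Algebra.adjoin K (Set.range a)) :=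
    { (Algebra.adjoin K (Set.range a)).toRing with
      mul_comm := (Algebra.isMulCommutative_adjoin K (by
        rintro _ ⟨i, rfl⟩ _ ⟨j, rfl⟩
        exact ha i j)).is_comm.comm }
  (Algebra.adjoin K (Set.range a)).val.comp
    (MvPolynomial.aeval fun i =>
      (⟨a i, Algebra.subset_adjoin ⟨i, rfl⟩⟩ : Algebra.adjoin K (Set.range a)))

@[simp] theorem commAeval_X {K ι M : Type*} [Field K] [AddCommGroup M] [Module K M]
    (a : ι → Module.End K M) (ha : ∀ i j, a i * a j = a j * a i) (i : ι) :
    commAeval a ha (MvPolynomial.X i) = a i := by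
  simp [commAeval]

/-- The polynomial algebra `K[U, V]`, where `U = {u_j}` and `V = {v_j}` are indexed by `X`. -/
abbrev PolyUV (K X : Type*) [Field K] : Type _ := MvPolynomial (X ⊕ X) K

/-- The variable `u_j`. -/
abbrev u (K : Type*) [Field K] {X : Type*} (j : X) : PolyUV K X := MvPolynomial.X (Sum.inl j)

/-- The variable `v_j`. -/
abbrev v (K : Type*) [Field K] {X : Type*} (j : X) : PolyUV K X := MvPolynomial.X (Sum.inr j)

section Action

variable {K : Type*} [Field K] {X : Type*}

/-- The action of `K[U, V]` on `F'`. -/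
def actionHom : PolyUV K X →ₐ[K] Module.End K (commIdeal K X) :=
  commAeval (K := K) (M := commIdeal K X) (Sum.elim leftOp adOp) (by
    rintro (i | i) (j | j)
    · exact leftOp_comm i j
    · exact leftOp_adOp_comm i j
    · exact (leftOp_adOp_comm j i).symm
    · exact adOp_comm i j)

/-- `F'` as a `K[U, V]`-module. -/
instance : Module (PolyUV K X) (commIdeal K X) :=
  Module.compHom (commIdeal K X) (actionHom (K := K) (X := X)).toRingHom

theorem smul_def (p : PolyUV K X) (f : commIdeal K X) : p • f = actionHom p f := rfl

theorem u_smul (j : X) (f : commIdeal K X) :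
    ((u K j • f : commIdeal K X) : FreeMet K X) = gen K j * f := by
  simp [smul_def, actionHom, leftOp]

theorem v_smul (j : X) (f : commIdeal K X) :
    ((v K j • f : commIdeal K X) : FreeMet K X) = f * gen K j - gen K j * f := by
  simp [smul_def, actionHom, adOp]

/-- The commutator `[x_i, x_j]` as an element of `F'`. -/
def comm (i j : X) : commIdeal K X :=
  ⟨gen K i * gen K j - gen K j * gen K i, comm_mem _ _⟩

/-- The linear map `F(X)' → F(Y)'` induced by a map `X → Y` of the generators. -/
def commMap {Y : Type*} (f : X → Y) : commIdeal K X →ₗ[K] commIdeal K Y :=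
  (map (K := K) f).toLinearMap.restrict (by
    intro c hc
    have hc := mem_commIdeal.1 hc
    induction hc using TwoSidedIdeal.span_induction with
    | mem x h =>
      obtain ⟨p, q, rfl⟩ := h
      simpa using comm_mem (map (K := K) f p) (map (K := K) f q)
    | zero => simp
    | add x y hx hy h1 h2 =>
      rw [map_add]; exact add_mem (h1 (mem_commIdeal.2 hx)) (h2 (mem_commIdeal.2 hy))
    | neg x hx h1 => rw [map_neg]; exact neg_mem (h1 (mem_commIdeal.2 hx))
    | left_absorb r x hx h1 =>
      simpa using mul_mem_left (map (K := K) f r) (h1 (mem_commIdeal.2 hx))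
    | right_absorb r x hx h1 =>
      simpa using mul_mem_right (map (K := K) f r) (h1 (mem_commIdeal.2 hx)))

/-! ### Constants -/

/-- The vector space `(F')^δ` of the constants in the commutator ideal of the linear derivation
`δ` with matrix `α`. -/
def commConst [Fintype X] (α : Matrix X X K) : Submodule K (commIdeal K X) :=
  LinearMap.ker (linDeriv α ∘ₗ (commIdeal K X).subtype)

/-- The linear derivation of `K[U, V]` with matrix `α`, acting on the `u_j` and on the `v_j` in the
same way: `δ(u_j) = ∑ i, α i j • u_i` and `δ(v_j) = ∑ i, α i j • v_i`. -/
def polyDeriv [Fintype X] (α : Matrix X X K) : Derivation K (PolyUV K X) (PolyUV K X) :=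
  MvPolynomial.mkDerivation K
    (Sum.elim (fun j => ∑ i, α i j • u K i) (fun j => ∑ i, α i j • v K i))

variable (K X) in
/-- The ideal `K[U, V]_ω = K[U] ⊗ ω(K[V])` of `K[U, V]`, where `ω(K[V])` is the augmentation ideal
of `K[V]`: the ideal of `K[U, V]` generated by `V`. -/
def omegaIdeal : Ideal (PolyUV K X) := Ideal.span (Set.range (v K))

/-- The vector space `K[U, V]_ω^δ` of the constants in `K[U, V]_ω` of the linear derivation with
matrix `α`. -/
def omegaConst [Fintype X] (α : Matrix X X K) : Submodule K (PolyUV K X) :=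
  (omegaIdeal K X).restrictScalars K ⊓ LinearMap.ker (polyDeriv α).toLinearMap

end Action

/-! ### The map `π`

The variables `x_1, …, x_d`, `d = n + 1`, are indexed by `Fin (n + 1)`; the last one `x_d` has index
`Fin.last n`, and `Fin n` embeds in `Fin (n + 1)` by `Fin.castSucc`. -/

section Pi

variable (K : Type*) [Field K] (n : ℕ)

/-- The inclusion of `K[U_{d-1}, V_{d-1}]` in `K[U_d, V_d]`. -/
def polyIncl : PolyUV K (Fin n) →ₐ[K] PolyUV K (Fin (n + 1)) :=
  MvPolynomial.rename (Sum.map Fin.castSucc Fin.castSucc)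

/-- The value of `π` on a monomial `∏ u_j ^ s(u_j) * ∏ v_j ^ s(v_j)`: one commutator `[x_d, x_j]`
for each of the `s(v_j)` occurrences of `v_j` in the monomial, acted upon by the monomial with this
occurrence of `v_j` removed. -/
def piMonomial (s : Fin n ⊕ Fin n →₀ ℕ) : commIdeal K (Fin (n + 1)) :=
  ∑ j : Fin n, s (Sum.inr j) •
    (polyIncl K n (MvPolynomial.monomial (s - Finsupp.single (Sum.inr j) 1) 1) •
      comm (Fin.last n) j.castSucc)

/-- The `K`-linear map `π` with
`π(u_{i_1} ⋯ u_{i_p} v_{j_1} ⋯ v_{j_q}) =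
  ∑ k, [x_d, x_{j_k}] v_{j_1} ⋯ v_{j_{k-1}} v_{j_{k+1}} ⋯ v_{j_q} u_{i_1} ⋯ u_{i_p}`;
it vanishes on the monomials without variables from `V_{d-1}`. -/
def piMap : PolyUV K (Fin n) →ₗ[K] commIdeal K (Fin (n + 1)) :=
  (MvPolynomial.basisMonomials (Fin n ⊕ Fin n) K).constr K (piMonomial K n)

end Pi

end FreeMetab

end

/-!
Write `A_d = K[U_d, V_d]`. The theorem comes from a decomposition of the whole commutator ideal:
every element of `F_d'` is, in a unique way, a sum
`∑ f_{pq} u_d^p v_d^q + ∑ π(g_{pq}) u_d^p v_d^q` with `f_{pq}` in `F_{d-1}'` and `g_{pq}` in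
`K[U_{d-1}, V_{d-1}]_ω`. This is the bijectivity of the map `assemble`. Since `δ` kills `u_d` and
`v_d`, and commutes both with the inclusion of `F_{d-1}'` and with `π`, it acts on such a sum
coefficient by coefficient (`commDeriv_assemble`). Hence the sum is a constant if and only if all the
`f_{pq}` and all the `g_{pq}` are constants, and bases of the two spaces of coefficients give a basis
of `(F_d')^δ`.

*Existence* (`assemble_surjective`). `F_d'` is generated by the commutators `[x_i, x_j]` as an
`A_d`-module (`span_comm_eq_top`), so it suffices that the span of the sums above is closed under the
variables. The map `π` is a derivation over `A_{d-1}` with `π(u_j) = 0` and `π(v_j) = [x_d, x_j]`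
(`piMap_eq`, `piMap_mul`), and only the products `v_k π(m)`, for a monomial `m` of degree `s` in `V`,
require an argument: by the Jacobi identity `(s + 1) v_k π(m)` equals `s π(v_k m)` modulo
`F_{d-1}' v_d` (`succ_smul_v_smul_piMap`), and `s + 1` is invertible in characteristic `0`.

*Uniqueness* (`assemble_injective`). For `c : X → A_d` the triangular matrices with rows
`(u_j, c_j)` and `(0, u_j + v_j)` satisfy the metabelian identity, and the upper right entry of the
corresponding representation is an `A_d`-linear map `foxMap c : F_d' → A_d` with
`[x_i, x_j] ↦ c_i v_j - c_j v_i`. For `c` the `d`-th unit vector this map kills `F_{d-1}'` and sends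
`π(g)` to `E g`, where `E = ∑ v_j ∂/∂v_j` is the Euler operator, injective on the polynomials in
`K[U_{d-1}, V_{d-1}]_ω` (`euler_injOn`). So the `g_{pq}` are determined; the other unit vectors
determine the `f_{pq}` by induction on `d` (`eq_zero_of_foxMap`).
-/

noncomputable section

namespace FreeMetab

/-! ### Generators of the commutator ideal -/

section General

variable {K : Type*} [Field K] {X : Type*}

theorem induction_gen {P : FreeMet K X → Prop} (hK : ∀ c : K, P (algebraMap K _ c))
    (hgen : ∀ j, P (gen K j)) (hmul : ∀ a b, P a → P b → P (a * b))
    (hadd : ∀ a b, P a → P b → P (a + b)) (a : FreeMet K X) : P a := by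
  obtain ⟨a, rfl⟩ := quotHom_surjective a
  induction a using FreeAlgebra.induction with
  | grade0 c => rw [AlgHom.commutes]; exact hK c
  | grade1 j => exact hgen j
  | mul a b ha hb => rw [map_mul]; exact hmul _ _ ha hb
  | add a b ha hb => rw [map_add]; exact hadd _ _ ha hb

instance : IsScalarTower K (PolyUV K X) (commIdeal K X) :=
  IsScalarTower.of_algebraMap_smul fun c f => by
    rw [smul_def, AlgHom.commutes, Module.algebraMap_end_apply]

/-- The underlying space of the `K[U, V]`-submodule of `F'` generated by the commutators of the
free generators. -/
def genSpan (K X : Type*) [Field K] : Submodule K (FreeMet K X) :=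
  ((Submodule.span (PolyUV K X)
    (Set.range fun p : X × X => comm (K := K) p.1 p.2)).restrictScalars K).map
      (commIdeal K X).subtype

theorem genSpan_gen_mul (j : X) {c : FreeMet K X} (hc : c ∈ genSpan K X) :
    gen K j * c ∈ genSpan K X := by
  obtain ⟨y, hy, rfl⟩ := hc
  exact ⟨u K j • y, Submodule.smul_mem (Submodule.span _ _) _ hy, u_smul j y⟩

theorem genSpan_mul_gen (j : X) {c : FreeMet K X} (hc : c ∈ genSpan K X) :
    c * gen K j ∈ genSpan K X := by
  obtain ⟨y, hy, rfl⟩ := hc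
  refine ⟨(u K j + v K j) • y, Submodule.smul_mem (Submodule.span _ _) _ hy, ?_⟩
  rw [add_smul]
  simp [u_smul, v_smul]

theorem genSpan_mul_left (a : FreeMet K X) :
    ∀ c ∈ genSpan K X, a * c ∈ genSpan K X := by
  induction a using induction_gen with
  | hK k => intro c hc; rw [← Algebra.smul_def]; exact Submodule.smul_mem _ _ hc
  | hgen j => exact fun c hc => genSpan_gen_mul j hc
  | hmul a b ha hb => intro c hc; rw [mul_assoc]; exact ha _ (hb _ hc)
  | hadd a b ha hb => intro c hc; rw [add_mul]; exact add_mem (ha _ hc) (hb _ hc)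

theorem genSpan_mul_right (a : FreeMet K X) :
    ∀ c ∈ genSpan K X, c * a ∈ genSpan K X := by
  induction a using induction_gen with
  | hK k =>
    intro c hc; rw [← Algebra.commutes, ← Algebra.smul_def]; exact Submodule.smul_mem _ _ hc
  | hgen j => exact fun c hc => genSpan_mul_gen j hc
  | hmul a b ha hb => intro c hc; rw [← mul_assoc]; exact hb _ (ha _ hc)
  | hadd a b ha hb => intro c hc; rw [mul_add]; exact add_mem (ha _ hc) (hb _ hc)

theorem commutator_mem_genSpan (a b : FreeMet K X) : a * b - b * a ∈ genSpan K X := by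
  induction a using induction_gen with
  | hK k => rw [Algebra.commutes, sub_self]; exact zero_mem _
  | hgen i =>
    induction b using induction_gen with
    | hK k => rw [Algebra.commutes, sub_self]; exact zero_mem _
    | hgen j => exact ⟨comm i j, Submodule.subset_span ⟨(i, j), rfl⟩, rfl⟩
    | hmul a b ha hb =>
      have h : gen K i * (a * b) - a * b * gen K i = (gen K i * a - a * gen K i) * b
        + a * (gen K i * b - b * gen K i) := by noncomm_ring
      rw [h]
      exact add_mem (genSpan_mul_right _ _ ha) (genSpan_mul_left _ _ hb)
    | hadd a b ha hb =>
      have h : gen K i * (a + b) - (a + b) * gen K i = (gen K i * a - a * gen K i)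
        + (gen K i * b - b * gen K i) := by noncomm_ring
      rw [h]
      exact add_mem ha hb
  | hmul a a' ha ha' =>
    have h : a * a' * b - b * (a * a') = (a * b - b * a) * a'
      + a * (a' * b - b * a') := by noncomm_ring
    rw [h]
    exact add_mem (genSpan_mul_right _ _ ha) (genSpan_mul_left _ _ ha')
  | hadd a a' ha ha' =>
    have h : (a + a') * b - b * (a + a') = (a * b - b * a) + (a' * b - b * a') := by noncomm_ring
    rw [h]
    exact add_mem ha ha'

theorem commIdeal_le_genSpan : commIdeal K X ≤ genSpan K X := by
  intro c hc
  replace hc := mem_commIdeal.1 hc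
  induction hc using TwoSidedIdeal.span_induction with
  | mem x h => obtain ⟨f, g, rfl⟩ := h; exact commutator_mem_genSpan f g
  | zero => exact zero_mem _
  | add x y _ _ hx hy => exact add_mem hx hy
  | neg x _ hx => exact neg_mem hx
  | left_absorb r x _ hx => exact genSpan_mul_left r x hx
  | right_absorb r x _ hx => exact genSpan_mul_right r x hx

/-- `F'` is generated by the commutators `[x_i, x_j]` as a `K[U, V]`-module. -/
theorem span_comm_eq_top : Submodule.span (PolyUV K X)
    (Set.range fun p : X × X => comm (K := K) p.1 p.2) = ⊤ := by
  refine eq_top_iff.2 fun f _ => ?_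
  obtain ⟨y, hy, hyf⟩ := commIdeal_le_genSpan f.2
  rwa [← Subtype.ext hyf]

theorem commIdeal_induction {P : commIdeal K X → Prop} (hcomm : ∀ i j : X, P (comm i j))
    (hzero : P 0) (hadd : ∀ f g, P f → P g → P (f + g))
    (hK : ∀ (c : K) f, P f → P (c • f))
    (hu : ∀ (i : X) (f : commIdeal K X), P f → P (u K i • f))
    (hv : ∀ (i : X) (f : commIdeal K X), P f → P (v K i • f))
    (f : commIdeal K X) : P f := by
  have hsmul : ∀ (p : PolyUV K X) (f : commIdeal K X), P f → P (p • f) := by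
    intro p
    induction p using MvPolynomial.induction_on with
    | C c =>
      intro f hf
      rw [← MvPolynomial.algebraMap_eq, algebraMap_smul]
      exact hK c f hf
    | add p q hp hq => intro f hf; rw [add_smul]; exact hadd _ _ (hp f hf) (hq f hf)
    | mul_X p i hp =>
      intro f hf
      rw [mul_smul]
      rcases i with i | i
      · exact hp _ (hu i f hf)
      · exact hp _ (hv i f hf)
  have hf : f ∈ Submodule.span (PolyUV K X)
    (Set.range fun p : X × X => comm (K := K) p.1 p.2) := by
    rw [span_comm_eq_top]; trivial
  induction hf using Submodule.span_induction with
  | mem x h => obtain ⟨p, rfl⟩ := h; exact hcomm p.1 p.2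
  | zero => exact hzero
  | add x y _ _ hx hy => exact hadd _ _ hx hy
  | smul a x _ hx => exact hsmul a x hx

/-! ### Triangular representations -/

/-- The algebra of upper triangular `2 × 2` matrices over `K[U, V]`. -/
def upperTri (K X : Type*) [Field K] :
    Subalgebra K (Matrix (Fin 2) (Fin 2) (PolyUV K X)) where
  carrier := {A | A 1 0 = 0}
  mul_mem' {A B} hA hB := by
    simp only [Set.mem_ofPred_eq] at *
    simp [Matrix.mul_apply, Fin.sum_univ_two, hA, hB]
  add_mem' {A B} hA hB := by
    simp only [Set.mem_ofPred_eq] at *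
    simp [hA, hB]
  algebraMap_mem' c := by
    simp [Matrix.algebraMap_matrix_apply]

theorem upperTri_metabelian (A B C D : upperTri K X) :
    (A * B - B * A) * (C * D - D * C) = 0 := by
  obtain ⟨A, hA⟩ := A
  obtain ⟨B, hB⟩ := B
  obtain ⟨C, hC⟩ := C
  obtain ⟨D, hD⟩ := D
  replace hA : A 1 0 = 0 := hA
  replace hB : B 1 0 = 0 := hB
  replace hC : C 1 0 = 0 := hC
  replace hD : D 1 0 = 0 := hD
  ext1
  ext i j : 2
  fin_cases i <;> fin_cases j <;>
    simp [Matrix.mul_apply, Fin.sum_univ_two, hA, hB, hC, hD] <;> ring_nf <;> simp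

/-- The representation `x_j ↦ !![u_j, c_j; 0, u_j + v_j]`. -/
def triRep (c : X → PolyUV K X) : FreeMet K X →ₐ[K] upperTri K X :=
  lift upperTri_metabelian fun j => ⟨!![u K j, c j; 0, u K j + v K j], by simp [upperTri]⟩

@[simp] theorem triRep_gen (c : X → PolyUV K X) (j : X) :
    (triRep c (gen K j)).1 = !![u K j, c j; 0, u K j + v K j] := by
  simp [triRep]

theorem triRep_one_zero (c : X → PolyUV K X) (f : FreeMet K X) : (triRep c f).1 1 0 = 0 :=
  (triRep c f).2

theorem triRep_mul_zero_one (c : X → PolyUV K X) (f g : FreeMet K X) :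
    (triRep c (f * g)).1 0 1 =
      (triRep c f).1 0 0 * (triRep c g).1 0 1 + (triRep c f).1 0 1 * (triRep c g).1 1 1 := by
  rw [map_mul]
  simp only [MulMemClass.coe_mul, Matrix.mul_apply, Fin.sum_univ_two]

/-- On the commutator ideal the representation by triangular matrices is strictly triangular. -/
theorem triRep_diag (c : X → PolyUV K X) {f : FreeMet K X} (hf : f ∈ commIdeal K X) :
    (triRep c f).1 0 0 = 0 ∧ (triRep c f).1 1 1 = 0 := by
  have h := triRep_one_zero c
  replace hf := mem_commIdeal.1 hf
  induction hf using TwoSidedIdeal.span_induction with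
  | mem x hx =>
    obtain ⟨a, b, rfl⟩ := hx
    simp [Matrix.mul_apply, Fin.sum_univ_two, h, mul_comm]
  | zero => simp
  | add x y _ _ hx hy => simp [hx, hy]
  | neg x _ hx => simp [hx]
  | left_absorb r x _ hx => simp [Matrix.mul_apply, Fin.sum_univ_two, h, hx]
  | right_absorb r x _ hx => simp [Matrix.mul_apply, Fin.sum_univ_two, h, hx]

/-- The `K[U, V]`-linear map `F' → K[U, V]` with `[x_i, x_j] ↦ c_i v_j - c_j v_i`, the upper right
entry of `triRep c`. -/
def foxMap (c : X → PolyUV K X) : commIdeal K X →ₗ[K] PolyUV K X where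
  toFun f := (triRep c f.1).1 0 1
  map_add' f g := by simp
  map_smul' k f := by simp

theorem foxMap_apply (c : X → PolyUV K X) (f : commIdeal K X) :
    foxMap c f = (triRep c f.1).1 0 1 := rfl

theorem foxMap_u_smul (c : X → PolyUV K X) (j : X) (f : commIdeal K X) :
    foxMap c (u K j • f) = u K j * foxMap c f := by
  rw [foxMap_apply, foxMap_apply, u_smul, triRep_mul_zero_one]
  simp [triRep_diag c f.2]

theorem foxMap_v_smul (c : X → PolyUV K X) (j : X) (f : commIdeal K X) :
    foxMap c (v K j • f) = v K j * foxMap c f := by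
  rw [foxMap_apply, foxMap_apply, v_smul, map_sub, AddSubgroupClass.coe_sub, Matrix.sub_apply,
    triRep_mul_zero_one, triRep_mul_zero_one]
  simp only [triRep_diag c f.2, triRep_gen, Matrix.of_apply, Matrix.cons_val]
  ring

theorem foxMap_smul (c : X → PolyUV K X) (p : PolyUV K X) (f : commIdeal K X) :
    foxMap c (p • f) = p * foxMap c f := by
  induction p using MvPolynomial.induction_on generalizing f with
  | C k =>
    rw [← MvPolynomial.algebraMap_eq, algebraMap_smul, map_smul, Algebra.smul_def]
  | add p q hp hq => rw [add_smul, map_add, hp, hq, add_mul]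
  | mul_X p i hp =>
    rw [mul_smul, hp, mul_assoc]
    rcases i with i | i
    · rw [foxMap_u_smul]
    · rw [foxMap_v_smul]

@[simp] theorem foxMap_comm (c : X → PolyUV K X) (i j : X) :
    foxMap c (comm i j) = c i * v K j - c j * v K i := by
  rw [foxMap_apply, comm, map_sub, AddSubgroupClass.coe_sub, Matrix.sub_apply,
    triRep_mul_zero_one, triRep_mul_zero_one]
  simp only [triRep_gen, Matrix.of_apply, Matrix.cons_val]
  ring

/-! ### Linear derivations -/

section Derivation

variable [Fintype X]

theorem linDeriv_gen (α : Matrix X X K) (j : X) :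
    linDeriv α (gen K j) = ∑ i, α i j • gen K i := deriv_gen _ _

theorem linDeriv_mul (α : Matrix X X K) (f g : FreeMet K X) :
    linDeriv α (f * g) = linDeriv α f * g + f * linDeriv α g := deriv_mul _ _ _

theorem linDeriv_algebraMap (α : Matrix X X K) (c : K) :
    linDeriv α (algebraMap K (FreeMet K X) c) = 0 := by
  have h := linDeriv_mul α 1 1
  rw [mul_one, mul_one, one_mul, right_eq_add] at h
  rw [Algebra.algebraMap_eq_smul_one, map_smul, h, smul_zero]

theorem linDeriv_mem (α : Matrix X X K) {c : FreeMet K X} (hc : c ∈ commIdeal K X) :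
    linDeriv α c ∈ commIdeal K X := by
  replace hc := mem_commIdeal.1 hc
  induction hc using TwoSidedIdeal.span_induction with
  | mem x h =>
    obtain ⟨a, b, rfl⟩ := h
    have h : linDeriv α (a * b - b * a) = (linDeriv α a * b - b * linDeriv α a) +
        (a * linDeriv α b - linDeriv α b * a) := by
      rw [map_sub, linDeriv_mul, linDeriv_mul]; abel
    rw [h]
    exact add_mem (comm_mem _ _) (comm_mem _ _)
  | zero => rw [map_zero]; exact zero_mem _
  | add x y _ _ hx hy => rw [map_add]; exact add_mem hx hy
  | neg x _ hx => rw [map_neg]; exact neg_mem hx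
  | left_absorb r x h hx =>
    rw [linDeriv_mul]
    exact add_mem (mul_mem_left _ (mem_commIdeal.2 h)) (mul_mem_left _ hx)
  | right_absorb r x h hx =>
    rw [linDeriv_mul]
    exact add_mem (mul_mem_right _ hx) (mul_mem_right _ (mem_commIdeal.2 h))

/-- The restriction of a linear derivation to the commutator ideal. -/
def commDeriv (α : Matrix X X K) : commIdeal K X →ₗ[K] commIdeal K X :=
  (linDeriv α).restrict fun _ => linDeriv_mem α

theorem coe_commDeriv (α : Matrix X X K) (f : commIdeal K X) :
    (commDeriv α f : FreeMet K X) = linDeriv α f.1 := rfl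

theorem mem_commConst (α : Matrix X X K) (f : commIdeal K X) :
    f ∈ commConst α ↔ commDeriv α f = 0 := by
  rw [commConst, LinearMap.mem_ker, ← Submodule.coe_eq_zero]
  rfl

theorem polyDeriv_u (α : Matrix X X K) (j : X) : polyDeriv α (u K j) = ∑ i, α i j • u K i :=
  MvPolynomial.mkDerivation_X _ _ _

theorem polyDeriv_v (α : Matrix X X K) (j : X) : polyDeriv α (v K j) = ∑ i, α i j • v K i :=
  MvPolynomial.mkDerivation_X _ _ _

theorem commDeriv_u_smul (α : Matrix X X K) (j : X) (f : commIdeal K X) :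
    commDeriv α (u K j • f) = polyDeriv α (u K j) • f + u K j • commDeriv α f := by
  refine Subtype.ext ?_
  rw [coe_commDeriv, u_smul, linDeriv_mul, linDeriv_gen, polyDeriv_u, Submodule.coe_add, u_smul,
    coe_commDeriv, Finset.sum_smul, Finset.sum_mul, AddSubmonoidClass.coe_finsetSum]
  congr 1
  refine Finset.sum_congr rfl fun i _ => ?_
  rw [smul_assoc, Submodule.coe_smul, u_smul, smul_mul_assoc]

theorem commDeriv_v_smul (α : Matrix X X K) (j : X) (f : commIdeal K X) :
    commDeriv α (v K j • f) = polyDeriv α (v K j) • f + v K j • commDeriv α f := by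
  refine Subtype.ext ?_
  have h : ((polyDeriv α (v K j) • f : commIdeal K X) : FreeMet K X) =
      f.1 * linDeriv α (gen K j) - linDeriv α (gen K j) * f.1 := by
    rw [linDeriv_gen, polyDeriv_v, Finset.sum_smul, AddSubmonoidClass.coe_finsetSum,
      Finset.mul_sum, Finset.sum_mul, ← Finset.sum_sub_distrib]
    refine Finset.sum_congr rfl fun i _ => ?_
    rw [smul_assoc, Submodule.coe_smul, v_smul, smul_mul_assoc, mul_smul_comm, smul_sub]
  rw [coe_commDeriv, v_smul, map_sub, linDeriv_mul, linDeriv_mul, Submodule.coe_add, h, v_smul,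
    coe_commDeriv]
  abel

theorem commDeriv_smul (α : Matrix X X K) (p : PolyUV K X) (f : commIdeal K X) :
    commDeriv α (p • f) = polyDeriv α p • f + p • commDeriv α f := by
  induction p using MvPolynomial.induction_on generalizing f with
  | C k =>
    rw [← MvPolynomial.algebraMap_eq, Derivation.map_algebraMap, algebraMap_smul, algebraMap_smul,
      map_smul, zero_smul, zero_add]
  | add p q hp hq => simp only [add_smul, map_add, hp, hq]; abel
  | mul_X p i hp =>
    have hX : commDeriv α ((MvPolynomial.X i : PolyUV K X) • f) =
        polyDeriv α (MvPolynomial.X i) • f + (MvPolynomial.X i : PolyUV K X) • commDeriv α f := by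
      rcases i with i | i
      · exact commDeriv_u_smul α i f
      · exact commDeriv_v_smul α i f
    rw [mul_smul, hp, hX, Derivation.leibniz, smul_add, add_smul, mul_smul, smul_eq_mul,
      smul_eq_mul, mul_smul, mul_smul, smul_comm (polyDeriv α p)]
    abel

theorem commDeriv_comm (α : Matrix X X K) (i j : X) :
    commDeriv α (comm i j) = ∑ k, (α k i • comm k j + α k j • comm i k) := by
  refine Subtype.ext ?_
  rw [coe_commDeriv, AddSubmonoidClass.coe_finsetSum, comm, map_sub, linDeriv_mul, linDeriv_mul,
    linDeriv_gen, linDeriv_gen, Finset.sum_mul, Finset.mul_sum, Finset.sum_mul, Finset.mul_sum,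
    ← Finset.sum_add_distrib, ← Finset.sum_add_distrib, ← Finset.sum_sub_distrib]
  refine Finset.sum_congr rfl fun k _ => ?_
  simp only [comm, Submodule.coe_add, Submodule.coe_smul, smul_sub, smul_mul_assoc, mul_smul_comm]
  abel

theorem polyDeriv_mem_omegaIdeal (α : Matrix X X K) {g : PolyUV K X} (hg : g ∈ omegaIdeal K X) :
    polyDeriv α g ∈ omegaIdeal K X := by
  have hv : ∀ i, v K i ∈ omegaIdeal K X := fun i => Ideal.subset_span ⟨i, rfl⟩
  rw [omegaIdeal] at hg
  induction hg using Submodule.span_induction with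
  | mem x h =>
    obtain ⟨j, rfl⟩ := h
    rw [polyDeriv_v]
    exact sum_mem fun i _ => Submodule.smul_of_tower_mem _ _ (hv i)
  | zero => rw [map_zero]; exact zero_mem _
  | add x y _ _ hx hy => rw [map_add]; exact add_mem hx hy
  | smul a x hx' hx =>
    rw [smul_eq_mul, Derivation.leibniz]
    exact add_mem (Ideal.mul_mem_left _ _ hx) (Ideal.mul_mem_right _ _ hx')

end Derivation

end General

/-! ### Functoriality, and `π` as a derivation -/

variable {K : Type*} [Field K] {n : ℕ}

theorem map_gen {X Y : Type*} (f : X → Y) (j : X) : map (K := K) f (gen K j) = gen K (f j) := by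
  simp [map]

theorem coe_commMap {X Y : Type*} (f : X → Y) (c : commIdeal K X) :
    (commMap f c : FreeMet K Y) = map f c.1 := rfl

theorem commMap_comm {X Y : Type*} (f : X → Y) (i j : X) :
    commMap (K := K) f (comm i j) = comm (f i) (f j) :=
  Subtype.ext <| by simp [coe_commMap, comm, map_gen]

theorem polyIncl_u (j : Fin n) : polyIncl K n (u K j) = u K j.castSucc := by simp [polyIncl]

theorem polyIncl_v (j : Fin n) : polyIncl K n (v K j) = v K j.castSucc := by simp [polyIncl]

theorem commMap_u_smul (j : Fin n) (f : commIdeal K (Fin n)) :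
    commMap Fin.castSucc (u K j • f) = u K j.castSucc • commMap Fin.castSucc f :=
  Subtype.ext <| by simp [coe_commMap, u_smul, map_gen]

theorem commMap_v_smul (j : Fin n) (f : commIdeal K (Fin n)) :
    commMap Fin.castSucc (v K j • f) = v K j.castSucc • commMap Fin.castSucc f :=
  Subtype.ext <| by simp [coe_commMap, v_smul, map_gen]

theorem commMap_smul (p : PolyUV K (Fin n)) (f : commIdeal K (Fin n)) :
    commMap Fin.castSucc (p • f) = polyIncl K n p • commMap Fin.castSucc f := by
  induction p using MvPolynomial.induction_on generalizing f with
  | C k =>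
    rw [← MvPolynomial.algebraMap_eq, algebraMap_smul, map_smul, AlgHom.commutes, algebraMap_smul]
  | add p q hp hq => rw [add_smul, map_add, hp, hq, map_add, add_smul]
  | mul_X p i hp =>
    rw [mul_smul, hp, map_mul, mul_smul]
    rcases i with i | i
    · rw [commMap_u_smul, polyIncl_u]
    · rw [commMap_v_smul, polyIncl_v]

/-- The Jacobi identity in `F'`. -/
theorem v_smul_comm {X : Type*} (i j k : X) :
    v K k • comm (K := K) i j = v K j • comm i k + v K i • comm k j := by
  refine Subtype.ext ?_
  simp only [Submodule.coe_add, v_smul, comm]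
  noncomm_ring

theorem piMap_monomial (s : Fin n ⊕ Fin n →₀ ℕ) :
    piMap K n (MvPolynomial.monomial s 1) = piMonomial K n s := by
  rw [piMap, ← congrFun (MvPolynomial.coe_basisMonomials _ K) s, Module.Basis.constr_basis]

/-- `π` is the derivation with values in `F'` such that `π(u_j) = 0` and `π(v_j) = [x_d, x_j]`,
written in terms of partial derivatives. -/
theorem piMap_eq (g : PolyUV K (Fin n)) : piMap K n g =
    ∑ j : Fin n, polyIncl K n (MvPolynomial.pderiv (Sum.inr j) g) •
      comm (Fin.last n) j.castSucc := by
  induction g using MvPolynomial.induction_on' with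
  | monomial s c =>
    have h : MvPolynomial.monomial s c = c • MvPolynomial.monomial s (1 : K) := by
      rw [MvPolynomial.smul_monomial, smul_eq_mul, mul_one]
    rw [h, map_smul, piMap_monomial, piMonomial, Finset.smul_sum]
    refine Finset.sum_congr rfl fun j _ => ?_
    have h2 : MvPolynomial.monomial (s - Finsupp.single (Sum.inr j) 1) ((1 : K) * s (Sum.inr j)) =
        s (Sum.inr j) • MvPolynomial.monomial (s - Finsupp.single (Sum.inr j) 1) (1 : K) := by
      rw [MvPolynomial.smul_monomial, nsmul_eq_mul, one_mul, mul_one]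
    rw [Derivation.map_smul, MvPolynomial.pderiv_monomial, h2, map_smul, smul_assoc, map_nsmul,
      smul_assoc]
  | add p q hp hq => simp only [map_add, add_smul, Finset.sum_add_distrib, hp, hq]

theorem piMap_mul (g h : PolyUV K (Fin n)) :
    piMap K n (g * h) = polyIncl K n g • piMap K n h + polyIncl K n h • piMap K n g := by
  simp only [piMap_eq, Finset.smul_sum, ← Finset.sum_add_distrib]
  refine Finset.sum_congr rfl fun j _ => ?_
  rw [Derivation.leibniz]
  simp only [smul_eq_mul, map_add, map_mul, add_smul, mul_smul]

theorem piMap_C (c : K) : piMap K n (MvPolynomial.C c) = 0 := by simp [piMap_eq]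

theorem piMap_u (j : Fin n) : piMap K n (u K j) = 0 := by
  rw [piMap_eq]
  refine Finset.sum_eq_zero fun i _ => ?_
  rw [MvPolynomial.pderiv_X_of_ne (by simp), map_zero, zero_smul]

theorem piMap_v (j : Fin n) : piMap K n (v K j) = comm (Fin.last n) j.castSucc := by
  rw [piMap_eq, Finset.sum_eq_single j]
  · rw [MvPolynomial.pderiv_X_self, map_one, one_smul]
  · intro i _ hi
    rw [MvPolynomial.pderiv_X_of_ne (by simpa using hi.symm), map_zero, zero_smul]
  · simp

/-! ### The Euler operator in the variables `V` -/

/-- The Euler operator `∑ v_j ∂/∂v_j`: a monomial of degree `s` in `V` is an eigenvector with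
eigenvalue `s`. -/
def euler (K : Type*) [Field K] (n : ℕ) : PolyUV K (Fin n) →ₗ[K] PolyUV K (Fin n) :=
  ∑ j : Fin n, LinearMap.mulLeft K (v K j) ∘ₗ (MvPolynomial.pderiv (Sum.inr j)).toLinearMap

theorem euler_apply (g : PolyUV K (Fin n)) :
    euler K n g = ∑ j : Fin n, v K j * MvPolynomial.pderiv (Sum.inr j) g := by
  simp [euler]

theorem euler_monomial (s : Fin n ⊕ Fin n →₀ ℕ) (c : K) :
    euler K n (MvPolynomial.monomial s c) =
      ((∑ j, s (Sum.inr j) : ℕ) : K) • MvPolynomial.monomial s c := by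
  rw [euler_apply, Nat.cast_sum, Finset.sum_smul]
  refine Finset.sum_congr rfl fun j _ => ?_
  rw [MvPolynomial.X_mul_pderiv_monomial, Nat.cast_smul_eq_nsmul]

theorem coeff_euler (g : PolyUV K (Fin n)) (s : Fin n ⊕ Fin n →₀ ℕ) :
    (euler K n g).coeff s = ((∑ j, s (Sum.inr j) : ℕ) : K) * g.coeff s := by
  induction g using MvPolynomial.induction_on' with
  | monomial t c =>
    classical
    rw [euler_monomial, MvPolynomial.coeff_smul, MvPolynomial.coeff_monomial, smul_eq_mul]
    split_ifs with h
    · rw [h]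
    · simp
  | add p q hp hq => simp only [map_add, MvPolynomial.coeff_add, hp, hq, mul_add]

theorem mem_omegaIdeal_iff (g : PolyUV K (Fin n)) : g ∈ omegaIdeal K (Fin n) ↔
    ∀ s ∈ g.support, ∃ j, s (Sum.inr j) ≠ 0 := by
  have h : Set.range (v K (X := Fin n)) = MvPolynomial.X '' Set.range Sum.inr := by
    rw [← Set.range_comp]; rfl
  rw [omegaIdeal, h, MvPolynomial.mem_ideal_span_X_image]
  simp

theorem euler_injOn [CharZero K] {g : PolyUV K (Fin n)} (hg : g ∈ omegaIdeal K (Fin n))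
    (h : euler K n g = 0) : g = 0 := by
  ext s
  by_contra hs
  obtain ⟨j, hj⟩ := (mem_omegaIdeal_iff g).1 hg s (MvPolynomial.mem_support_iff.2 hs)
  have h1 := coeff_euler g s
  rw [h, MvPolynomial.coeff_zero, eq_comm, mul_eq_zero, Nat.cast_eq_zero,
    Finset.sum_eq_zero_iff] at h1
  exact h1.elim (fun h2 => hj (h2 j (Finset.mem_univ j))) hs

/-- The failure of `π` to be linear over the `v_k`: replace each `v_k [x_d, x_j]` in `v_k π(g)` by
`v_j [x_d, x_k] + v_d [x_k, x_j]`. -/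
theorem v_smul_piMap (k : Fin n) (g : PolyUV K (Fin n)) :
    v K k.castSucc • piMap K n g =
      polyIncl K n (euler K n g) • comm (Fin.last n) k.castSucc +
        v K (Fin.last n) • commMap Fin.castSucc
          (∑ j, MvPolynomial.pderiv (Sum.inr j) g • comm k j) := by
  rw [euler_apply, map_sum, map_sum, Finset.sum_smul, Finset.smul_sum, piMap_eq, Finset.smul_sum,
    ← Finset.sum_add_distrib]
  refine Finset.sum_congr rfl fun j _ => ?_
  rw [commMap_smul, commMap_comm, smul_comm, v_smul_comm, smul_add, map_mul, polyIncl_v,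
    mul_smul, smul_comm (v K j.castSucc), smul_comm (v K (Fin.last n))]

/-- For a monomial `m` of degree `s` in `V`, Euler's formula turns `v_smul_piMap` into
`(s + 1) v_k π(m) = s π(v_k m) + v_d f` with `f` in `F_{d-1}'`. -/
theorem succ_smul_v_smul_piMap (k : Fin n) (m : Fin n ⊕ Fin n →₀ ℕ) (c : K) :
    ((∑ j, m (Sum.inr j) : ℕ) + 1 : K) • v K k.castSucc • piMap K n (MvPolynomial.monomial m c) =
      ((∑ j, m (Sum.inr j) : ℕ) : K) • piMap K n (v K k * MvPolynomial.monomial m c) +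
        v K (Fin.last n) • commMap Fin.castSucc
          (∑ j, MvPolynomial.pderiv (Sum.inr j) (MvPolynomial.monomial m c) • comm k j) := by
  rw [add_smul, one_smul]
  -- By `v_smul_piMap` one copy of `v_k π(m)` becomes `s m [x_d, x_k]` up to `F_{d-1}' v_d`; with the
  -- other `s` copies it forms `s π(v_k m)`.
  nth_rw 2 [v_smul_piMap]
  rw [euler_monomial, map_smul, smul_assoc, ← add_assoc, ← smul_add, piMap_mul, polyIncl_v,
    piMap_v]

/-! ### Polynomials in `u_d` and `v_d` -/

/-- The monomial `u_d ^ p * v_d ^ q`. -/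
def lastMon (K : Type*) [Field K] (n : ℕ) (t : ℕ × ℕ) : PolyUV K (Fin (n + 1)) :=
  u K (Fin.last n) ^ t.1 * v K (Fin.last n) ^ t.2

/-- The evaluation which identifies `K[U_d, V_d]` with the polynomials in `v_d` and `u_d` over
`K[U_{d-1}, V_{d-1}]`. -/
def evalLast (K : Type*) [Field K] (n : ℕ) :
    PolyUV K (Fin (n + 1)) →ₐ[K] Polynomial (Polynomial (PolyUV K (Fin n))) :=
  MvPolynomial.aeval (Sum.elim
    (Fin.lastCases Polynomial.X fun i => Polynomial.C (Polynomial.C (u K i)))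
    (Fin.lastCases (Polynomial.C Polynomial.X) fun i => Polynomial.C (Polynomial.C (v K i))))

theorem evalLast_polyIncl (h : PolyUV K (Fin n)) :
    evalLast K n (polyIncl K n h) = Polynomial.C (Polynomial.C h) := by
  induction h using MvPolynomial.induction_on with
  | C c =>
    rw [← MvPolynomial.algebraMap_eq, AlgHom.commutes, AlgHom.commutes]
    rfl
  | add p q hp hq => simp only [map_add, hp, hq]
  | mul_X p i hp =>
    rw [map_mul, map_mul, hp, map_mul, map_mul]
    rcases i with i | i <;> simp [polyIncl, evalLast]

theorem evalLast_lastMon_mul (t : ℕ × ℕ) (h : PolyUV K (Fin n)) :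
    evalLast K n (lastMon K n t * polyIncl K n h) =
      Polynomial.C (Polynomial.C h * Polynomial.X ^ t.2) * Polynomial.X ^ t.1 := by
  rw [map_mul, evalLast_polyIncl, lastMon, map_mul, map_pow, map_pow]
  simp [evalLast]
  ring

/-- The monomials in `u_d` and `v_d` are linearly independent over `K[U_{d-1}, V_{d-1}]`. -/
theorem eq_zero_of_sum_lastMon (F : ℕ × ℕ →₀ PolyUV K (Fin n))
    (hF : (F.sum fun t h => lastMon K n t * polyIncl K n h) = 0) : F = 0 := by
  classical
  ext1 t
  have h := congrArg (fun q => ((evalLast K n q).coeff t.1).coeff t.2) hF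
  simp only [Finsupp.sum, map_sum, evalLast_lastMon_mul, Polynomial.finsetSum_coeff, map_zero,
    Polynomial.coeff_zero, Polynomial.coeff_C_mul_X_pow] at h
  rw [Finset.sum_eq_single t] at h
  · simpa using h
  · rintro ⟨p, q⟩ _ hne
    split_ifs with h1
    · rw [Polynomial.coeff_C_mul_X_pow, if_neg]
      rintro h2
      exact hne (Prod.ext h1.symm h2.symm)
    · simp
  · intro ht
    simp [Finsupp.notMem_support_iff.1 ht]

/-! ### Spanning of `F_d'` -/

/-- The sum of the spaces `F_{d-1}' u_d^p v_d^q` and `π(K[U_{d-1}, V_{d-1}]) u_d^p v_d^q`. -/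
def lastSpan (K : Type*) [Field K] (n : ℕ) : Submodule K (commIdeal K (Fin (n + 1))) :=
  Submodule.span K
    ((Set.range fun z : (ℕ × ℕ) × commIdeal K (Fin n) =>
        lastMon K n z.1 • commMap Fin.castSucc z.2) ∪
      (Set.range fun z : (ℕ × ℕ) × PolyUV K (Fin n) => lastMon K n z.1 • piMap K n z.2))

theorem smul_commMap_mem (t : ℕ × ℕ) (f : commIdeal K (Fin n)) :
    lastMon K n t • commMap Fin.castSucc f ∈ lastSpan K n :=
  Submodule.subset_span (Or.inl ⟨(t, f), rfl⟩)

theorem smul_piMap_mem (t : ℕ × ℕ) (g : PolyUV K (Fin n)) :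
    lastMon K n t • piMap K n g ∈ lastSpan K n :=
  Submodule.subset_span (Or.inr ⟨(t, g), rfl⟩)

theorem smul_mem_lastSpan {r : PolyUV K (Fin (n + 1))}
    (h1 : ∀ t f, r • lastMon K n t • commMap Fin.castSucc f ∈ lastSpan K n)
    (h2 : ∀ t g, r • lastMon K n t • piMap K n g ∈ lastSpan K n)
    {y : commIdeal K (Fin (n + 1))} (hy : y ∈ lastSpan K n) : r • y ∈ lastSpan K n := by
  induction hy using Submodule.span_induction with
  | mem x h =>
    rcases h with ⟨z, rfl⟩ | ⟨z, rfl⟩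
    · exact h1 _ _
    · exact h2 _ _
  | zero => rw [smul_zero]; exact zero_mem _
  | add x y _ _ hx hy => rw [smul_add]; exact add_mem hx hy
  | smul c x _ hx => rw [smul_comm]; exact Submodule.smul_mem _ _ hx

theorem u_last_mul_lastMon (t : ℕ × ℕ) :
    u K (Fin.last n) * lastMon K n t = lastMon K n (t.1 + 1, t.2) := by
  simp only [lastMon]; ring

theorem v_last_mul_lastMon (t : ℕ × ℕ) :
    v K (Fin.last n) * lastMon K n t = lastMon K n (t.1, t.2 + 1) := by
  simp only [lastMon]; ring

theorem u_last_smul_mem {y : commIdeal K (Fin (n + 1))} (hy : y ∈ lastSpan K n) :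
    u K (Fin.last n) • y ∈ lastSpan K n := by
  refine smul_mem_lastSpan (fun t f => ?_) (fun t g => ?_) hy
  · rw [← mul_smul, u_last_mul_lastMon]; exact smul_commMap_mem _ _
  · rw [← mul_smul, u_last_mul_lastMon]; exact smul_piMap_mem _ _

theorem v_last_smul_mem {y : commIdeal K (Fin (n + 1))} (hy : y ∈ lastSpan K n) :
    v K (Fin.last n) • y ∈ lastSpan K n := by
  refine smul_mem_lastSpan (fun t f => ?_) (fun t g => ?_) hy
  · rw [← mul_smul, v_last_mul_lastMon]; exact smul_commMap_mem _ _
  · rw [← mul_smul, v_last_mul_lastMon]; exact smul_piMap_mem _ _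

theorem lastMon_smul_mem (t : ℕ × ℕ) {y : commIdeal K (Fin (n + 1))} (hy : y ∈ lastSpan K n) :
    lastMon K n t • y ∈ lastSpan K n := by
  have hu : ∀ p : ℕ, ∀ z ∈ lastSpan K n, u K (Fin.last n) ^ p • z ∈ lastSpan K n := by
    intro p z hz
    induction p with
    | zero => rwa [pow_zero, one_smul]
    | succ p hp => rw [pow_succ', mul_smul]; exact u_last_smul_mem hp
  have hv : ∀ p : ℕ, ∀ z ∈ lastSpan K n, v K (Fin.last n) ^ p • z ∈ lastSpan K n := by
    intro p z hz
    induction p with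
    | zero => rwa [pow_zero, one_smul]
    | succ p hp => rw [pow_succ', mul_smul]; exact v_last_smul_mem hp
  rw [lastMon, mul_smul]
  exact hu _ _ (hv _ _ hy)

theorem commMap_mem (f : commIdeal K (Fin n)) : commMap Fin.castSucc f ∈ lastSpan K n := by
  simpa [lastMon] using smul_commMap_mem (0, 0) f

theorem piMap_mem (g : PolyUV K (Fin n)) : piMap K n g ∈ lastSpan K n := by
  simpa [lastMon] using smul_piMap_mem (0, 0) g

theorem u_castSucc_smul_mem (j : Fin n) {y : commIdeal K (Fin (n + 1))}
    (hy : y ∈ lastSpan K n) : u K j.castSucc • y ∈ lastSpan K n := by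
  refine smul_mem_lastSpan (fun t f => ?_) (fun t g => ?_) hy
  · rw [smul_comm, ← commMap_u_smul]; exact smul_commMap_mem _ _
  · have h := piMap_mul (u K j) g
    rw [piMap_u, smul_zero, add_zero, polyIncl_u] at h
    rw [smul_comm, ← h]
    exact smul_piMap_mem _ _

theorem v_castSucc_smul_piMap_mem [CharZero K] (k : Fin n) (g : PolyUV K (Fin n)) :
    v K k.castSucc • piMap K n g ∈ lastSpan K n := by
  induction g using MvPolynomial.induction_on' with
  | monomial m c =>
    have h0 : ((∑ j, m (Sum.inr j) : ℕ) + 1 : K) ≠ 0 := Nat.cast_add_one_ne_zero _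
    rw [← Submodule.smul_mem_iff _ h0, succ_smul_v_smul_piMap]
    exact add_mem (Submodule.smul_mem _ _ (piMap_mem _)) (v_last_smul_mem (commMap_mem _))
  | add p q hp hq => rw [map_add, smul_add]; exact add_mem hp hq

theorem v_castSucc_smul_mem [CharZero K] (j : Fin n) {y : commIdeal K (Fin (n + 1))}
    (hy : y ∈ lastSpan K n) : v K j.castSucc • y ∈ lastSpan K n := by
  refine smul_mem_lastSpan (fun t f => ?_) (fun t g => ?_) hy
  · rw [smul_comm, ← commMap_v_smul]; exact smul_commMap_mem _ _
  · rw [smul_comm]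
    exact lastMon_smul_mem _ (v_castSucc_smul_piMap_mem _ _)

theorem comm_swap {X : Type*} (i j : X) : comm (K := K) i j = -comm j i :=
  Subtype.ext <| by simp [comm]

theorem comm_self {X : Type*} (i : X) : comm (K := K) i i = 0 :=
  Subtype.ext <| by simp [comm]

theorem comm_mem_lastSpan (i j : Fin (n + 1)) : comm (K := K) i j ∈ lastSpan K n := by
  induction i using Fin.lastCases with
  | last =>
    induction j using Fin.lastCases with
    | last => rw [comm_self]; exact zero_mem _
    | cast j => rw [← piMap_v]; exact piMap_mem _
  | cast i =>
    induction j using Fin.lastCases with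
    | last => rw [comm_swap, ← piMap_v]; exact neg_mem (piMap_mem _)
    | cast j => rw [← commMap_comm]; exact commMap_mem _

theorem lastSpan_eq_top [CharZero K] : lastSpan K n = ⊤ := by
  refine eq_top_iff.2 fun f _ => ?_
  induction f using commIdeal_induction with
  | hcomm i j => exact comm_mem_lastSpan i j
  | hzero => exact zero_mem _
  | hadd f g hf hg => exact add_mem (hf trivial) (hg trivial)
  | hK c f hf => exact Submodule.smul_mem _ _ (hf trivial)
  | hu i f hf =>
    induction i using Fin.lastCases with
    | last => exact u_last_smul_mem (hf trivial)
    | cast i => exact u_castSucc_smul_mem i (hf trivial)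
  | hv i f hf =>
    induction i using Fin.lastCases with
    | last => exact v_last_smul_mem (hf trivial)
    | cast i => exact v_castSucc_smul_mem i (hf trivial)

/-- The ideal `K[U, V]_ω` as a vector space. -/
abbrev omega (K : Type*) [Field K] (n : ℕ) : Submodule K (PolyUV K (Fin n)) :=
  (omegaIdeal K (Fin n)).restrictScalars K

/-- The linear map `(f_{pq}, g_{pq}) ↦ ∑ f_{pq} u_d^p v_d^q + ∑ π(g_{pq}) u_d^p v_d^q`, for `f_{pq}`
in `F_{d-1}'` and `g_{pq}` in `K[U_{d-1}, V_{d-1}]_ω`. -/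
def assemble (K : Type*) [Field K] (n : ℕ) :
    ((ℕ × ℕ →₀ commIdeal K (Fin n)) × (ℕ × ℕ →₀ omega K n)) →ₗ[K] commIdeal K (Fin (n + 1)) :=
  LinearMap.coprod
    (Finsupp.lsum K fun t => actionHom (lastMon K n t) ∘ₗ commMap Fin.castSucc)
    (Finsupp.lsum K fun t => actionHom (lastMon K n t) ∘ₗ piMap K n ∘ₗ (omega K n).subtype)

theorem assemble_apply (F : ℕ × ℕ →₀ commIdeal K (Fin n)) (G : ℕ × ℕ →₀ omega K n) :
    assemble K n (F, G) = (F.sum fun t f => lastMon K n t • commMap Fin.castSucc f) +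
      G.sum fun t g => lastMon K n t • piMap K n g.1 := rfl

/-- Since `π` kills the monomials without variables from `V`, its values are already attained on
`K[U, V]_ω`. -/
theorem exists_omega_piMap (g : PolyUV K (Fin n)) :
    ∃ h : omega K n, piMap K n h.1 = piMap K n g := by
  induction g using MvPolynomial.induction_on' with
  | monomial m c =>
    by_cases hm : ∃ j, m (Sum.inr j) ≠ 0
    · refine ⟨⟨MvPolynomial.monomial m c, (mem_omegaIdeal_iff _).2 fun s hs => ?_⟩, rfl⟩
      rwa [Finset.mem_singleton.1 (MvPolynomial.support_monomial_subset hs)]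
    · refine ⟨0, ?_⟩
      push Not at hm
      simp [piMap_eq, hm]
  | add p q hp hq =>
    obtain ⟨a, ha⟩ := hp
    obtain ⟨b, hb⟩ := hq
    exact ⟨a + b, by rw [Submodule.coe_add, map_add, map_add, ha, hb]⟩

theorem assemble_surjective [CharZero K] : Function.Surjective (assemble K n) := by
  rw [← LinearMap.range_eq_top, eq_top_iff, ← lastSpan_eq_top, lastSpan, Submodule.span_le]
  rintro _ (⟨⟨t, f⟩, rfl⟩ | ⟨⟨t, g⟩, rfl⟩)
  · refine ⟨(Finsupp.single t f, 0), ?_⟩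
    rw [assemble_apply, Finsupp.sum_single_index (by simp), Finsupp.sum_zero_index, add_zero]
  · obtain ⟨h, hh⟩ := exists_omega_piMap g
    refine ⟨(0, Finsupp.single t h), ?_⟩
    rw [assemble_apply, Finsupp.sum_single_index (by simp), Finsupp.sum_zero_index, zero_add, hh]

/-! ### Uniqueness of the decomposition -/

theorem foxMap_commMap {c : Fin (n + 1) → PolyUV K (Fin (n + 1))} {c' : Fin n → PolyUV K (Fin n)}
    (hc : ∀ i, c i.castSucc = polyIncl K n (c' i)) (f : commIdeal K (Fin n)) :
    foxMap c (commMap Fin.castSucc f) = polyIncl K n (foxMap c' f) := by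
  induction f using commIdeal_induction with
  | hcomm i j =>
    rw [commMap_comm, foxMap_comm, foxMap_comm, hc, hc, map_sub, map_mul, map_mul, polyIncl_v,
      polyIncl_v]
  | hzero => simp
  | hadd f g hf hg => simp only [map_add, hf, hg]
  | hK k f hf => simp only [map_smul, hf]
  | hu i f hf => rw [commMap_u_smul, foxMap_u_smul, foxMap_u_smul, hf, map_mul, polyIncl_u]
  | hv i f hf => rw [commMap_v_smul, foxMap_v_smul, foxMap_v_smul, hf, map_mul, polyIncl_v]

theorem foxMap_last_commMap (f : commIdeal K (Fin n)) :
    foxMap (Pi.single (Fin.last n) 1) (commMap Fin.castSucc f) = 0 := by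
  rw [foxMap_commMap (c' := 0) (fun i => by simp [Fin.castSucc_ne_last])]
  have h : foxMap (0 : Fin n → PolyUV K (Fin n)) f = 0 := by
    induction f using commIdeal_induction with
    | hcomm i j => simp
    | hzero => simp
    | hadd f g hf hg => rw [map_add, hf, hg, add_zero]
    | hK k f hf => rw [map_smul, hf, smul_zero]
    | hu i f hf => rw [foxMap_u_smul, hf, mul_zero]
    | hv i f hf => rw [foxMap_v_smul, hf, mul_zero]
  rw [h, map_zero]

theorem foxMap_castSucc_commMap (j : Fin n) (f : commIdeal K (Fin n)) :
    foxMap (Pi.single j.castSucc 1) (commMap Fin.castSucc f) =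
      polyIncl K n (foxMap (Pi.single j 1) f) := by
  refine foxMap_commMap (fun i => ?_) f
  rcases eq_or_ne i j with rfl | h
  · simp
  · rw [Pi.single_eq_of_ne h, Pi.single_eq_of_ne (by simpa using h), map_zero]

theorem foxMap_last_piMap (g : PolyUV K (Fin n)) :
    foxMap (Pi.single (Fin.last n) 1) (piMap K n g) = polyIncl K n (euler K n g) := by
  rw [piMap_eq, euler_apply, map_sum, map_sum]
  refine Finset.sum_congr rfl fun j _ => ?_
  rw [foxMap_smul, foxMap_comm, map_mul, polyIncl_v]
  simp [Fin.castSucc_ne_last, mul_comm]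

/-- If `∑ f_{pq} u_d^p v_d^q + ∑ π(g_{pq}) u_d^p v_d^q` is annihilated by all the maps `foxMap`, the
coordinate of index `d` gives `g_{pq} = 0`, and the other ones annihilate the `f_{pq}`. -/
theorem foxMap_assemble [CharZero K] {F : ℕ × ℕ →₀ commIdeal K (Fin n)} {G : ℕ × ℕ →₀ omega K n}
    (h : ∀ j, foxMap (Pi.single j 1) (assemble K n (F, G)) = 0) :
    G = 0 ∧ ∀ t j, foxMap (Pi.single j 1) (F t) = 0 := by
  have hG : G = 0 := by
    have h1 := h (Fin.last n)
    rw [assemble_apply, map_add, map_finsuppSum, map_finsuppSum] at h1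
    simp only [foxMap_smul, foxMap_last_commMap, foxMap_last_piMap, mul_zero] at h1
    rw [Finsupp.sum_fun_zero, zero_add] at h1
    have h2 := eq_zero_of_sum_lastMon
      (Finsupp.mapRange.linearMap (euler K n ∘ₗ (omega K n).subtype) G) (by
        rw [Finsupp.mapRange.linearMap_apply, Finsupp.sum_mapRange_index (by simp)]
        exact h1)
    ext1 t
    exact Subtype.ext (euler_injOn (G t).2 (DFunLike.congr_fun h2 t))
  refine ⟨hG, fun t j => ?_⟩
  have h1 := h j.castSucc
  rw [hG, assemble_apply, Finsupp.sum_zero_index, add_zero, map_finsuppSum] at h1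
  simp only [foxMap_smul, foxMap_castSucc_commMap] at h1
  have h2 := eq_zero_of_sum_lastMon
    (Finsupp.mapRange.linearMap (foxMap (Pi.single j 1)) F) (by
      rw [Finsupp.mapRange.linearMap_apply, Finsupp.sum_mapRange_index (by simp)]
      exact h1)
  exact DFunLike.congr_fun h2 t

/-- The maps `foxMap` with unit vectors embed `F'` in a free `K[U, V]`-module. -/
theorem eq_zero_of_foxMap [CharZero K] : ∀ {n : ℕ} {f : commIdeal K (Fin n)},
    (∀ j, foxMap (Pi.single j 1) f = 0) → f = 0
  | 0, f, _ => by
    -- There are no commutators of generators, so `F_0' = 0`.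
    induction f using commIdeal_induction with
    | hcomm i j => exact i.elim0
    | hzero => rfl
    | hadd f g hf hg => rw [hf nofun, hg nofun, add_zero]
    | hK k f hf => rw [hf nofun, smul_zero]
    | hu i f hf => exact i.elim0
    | hv i f hf => exact i.elim0
  | n + 1, f, h => by
    obtain ⟨⟨F, G⟩, rfl⟩ := assemble_surjective f
    obtain ⟨hG, hF⟩ := foxMap_assemble h
    have hF0 : F = 0 := Finsupp.ext fun t => eq_zero_of_foxMap (hF t)
    rw [hF0, hG, ← Prod.zero_eq_mk, map_zero]

theorem assemble_injective [CharZero K] : Function.Injective (assemble K n) := by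
  refine (injective_iff_map_eq_zero _).2 ?_
  rintro ⟨F, G⟩ h
  obtain ⟨hG, hF⟩ := foxMap_assemble (F := F) (G := G) fun j => by rw [h, map_zero]
  have hF0 : F = 0 := Finsupp.ext fun t => eq_zero_of_foxMap (hF t)
  rw [hF0, hG, Prod.zero_eq_mk]

/-! ### Equivariance of the decomposition -/

/-- The character `x_j ↦ δ_{ij}`. -/
def coordHom {X : Type*} [DecidableEq X] (i : X) : FreeMet K X →ₐ[K] K :=
  lift (fun a b c e => by ring) (Pi.single i 1)

theorem coordHom_linDeriv {X : Type*} [Fintype X] [DecidableEq X] (α : Matrix X X K) (i j : X) :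
    coordHom i (linDeriv α (gen K j)) = α i j := by
  rw [linDeriv_gen, map_sum, Finset.sum_eq_single i]
  · simp [coordHom]
  · intro k _ hk
    simp [coordHom, hk]
  · simp

theorem apply_last_eq_zero {α : Matrix (Fin (n + 1)) (Fin (n + 1)) K}
    (h : linDeriv α (gen K (Fin.last n)) = 0) (i : Fin (n + 1)) : α i (Fin.last n) = 0 := by
  rw [← coordHom_linDeriv α, h, map_zero]

theorem last_apply_eq_zero {α : Matrix (Fin (n + 1)) (Fin (n + 1)) K} {j : Fin n}
    (h : linDeriv α (gen K j.castSucc) ∈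
      Submodule.span K (Set.range fun i : Fin n => gen K i.castSucc)) :
    α (Fin.last n) j.castSucc = 0 := by
  have hle : Submodule.span K (Set.range fun i : Fin n => gen K i.castSucc) ≤
      LinearMap.ker (coordHom (K := K) (Fin.last n)).toLinearMap := by
    rw [Submodule.span_le]
    rintro _ ⟨i, rfl⟩
    simp [coordHom, Fin.castSucc_ne_last]
  rw [← coordHom_linDeriv α]
  exact hle h

variable {α : Matrix (Fin (n + 1)) (Fin (n + 1)) K}

theorem linDeriv_map (h1 : ∀ j : Fin n, α (Fin.last n) j.castSucc = 0) (f : FreeMet K (Fin n)) :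
    linDeriv α (map Fin.castSucc f) =
      map Fin.castSucc (linDeriv (α.submatrix Fin.castSucc Fin.castSucc) f) := by
  induction f using induction_gen with
  | hK c => simp only [AlgHom.commutes, linDeriv_algebraMap, map_zero]
  | hgen j =>
    rw [map_gen, linDeriv_gen, linDeriv_gen, Fin.sum_univ_castSucc, h1, zero_smul, add_zero,
      map_sum]
    exact Finset.sum_congr rfl fun i _ => by rw [map_smul, map_gen]; rfl
  | hmul a b ha hb => simp only [map_mul, linDeriv_mul, map_add, ha, hb]
  | hadd a b ha hb => simp only [map_add, ha, hb]

theorem commDeriv_commMap (h1 : ∀ j : Fin n, α (Fin.last n) j.castSucc = 0)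
    (f : commIdeal K (Fin n)) : commDeriv α (commMap Fin.castSucc f) =
      commMap Fin.castSucc (commDeriv (α.submatrix Fin.castSucc Fin.castSucc) f) :=
  Subtype.ext (linDeriv_map h1 f.1)

theorem polyDeriv_polyIncl (h1 : ∀ j : Fin n, α (Fin.last n) j.castSucc = 0)
    (p : PolyUV K (Fin n)) : polyDeriv α (polyIncl K n p) =
      polyIncl K n (polyDeriv (α.submatrix Fin.castSucc Fin.castSucc) p) := by
  induction p using MvPolynomial.induction_on with
  | C c =>
    rw [← MvPolynomial.algebraMap_eq, AlgHom.commutes, Derivation.map_algebraMap,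
      Derivation.map_algebraMap, map_zero]
  | add p q hp hq => simp only [map_add, hp, hq]
  | mul_X p i hp =>
    have hX : polyDeriv α (polyIncl K n (MvPolynomial.X i)) =
        polyIncl K n (polyDeriv (α.submatrix Fin.castSucc Fin.castSucc) (MvPolynomial.X i)) := by
      rcases i with i | i
      · rw [polyIncl_u, polyDeriv_u, polyDeriv_u, Fin.sum_univ_castSucc, h1, zero_smul, add_zero,
          map_sum]
        exact Finset.sum_congr rfl fun k _ => by rw [map_smul, polyIncl_u]; rfl
      · rw [polyIncl_v, polyDeriv_v, polyDeriv_v, Fin.sum_univ_castSucc, h1, zero_smul, add_zero,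
          map_sum]
        exact Finset.sum_congr rfl fun k _ => by rw [map_smul, polyIncl_v]; rfl
    simp only [map_mul, Derivation.leibniz, smul_eq_mul, map_add, hp, hX]

theorem polyDeriv_lastMon (h0 : ∀ i, α i (Fin.last n) = 0) (t : ℕ × ℕ) :
    polyDeriv α (lastMon K n t) = 0 := by
  have hu : polyDeriv α (u K (Fin.last n)) = 0 := by simp [polyDeriv_u, h0]
  have hv : polyDeriv α (v K (Fin.last n)) = 0 := by simp [polyDeriv_v, h0]
  rw [lastMon, Derivation.leibniz, Derivation.leibniz_pow, Derivation.leibniz_pow, hu, hv]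
  simp

theorem commDeriv_lastMon_smul (h0 : ∀ i, α i (Fin.last n) = 0) (t : ℕ × ℕ)
    (f : commIdeal K (Fin (n + 1))) :
    commDeriv α (lastMon K n t • f) = lastMon K n t • commDeriv α f := by
  rw [commDeriv_smul, polyDeriv_lastMon h0, zero_smul, zero_add]

/-- The map `π` commutes with `δ`. -/
theorem commDeriv_piMap (h0 : ∀ i, α i (Fin.last n) = 0)
    (h1 : ∀ j : Fin n, α (Fin.last n) j.castSucc = 0) (g : PolyUV K (Fin n)) :
    commDeriv α (piMap K n g) =
      piMap K n (polyDeriv (α.submatrix Fin.castSucc Fin.castSucc) g) := by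
  induction g using MvPolynomial.induction_on with
  | C c =>
    rw [piMap_C, ← MvPolynomial.algebraMap_eq, Derivation.map_algebraMap, map_zero, map_zero]
  | add p q hp hq => simp only [map_add, hp, hq]
  | mul_X p i hp =>
    have hX : commDeriv α (piMap K n (MvPolynomial.X i)) =
        piMap K n (polyDeriv (α.submatrix Fin.castSucc Fin.castSucc) (MvPolynomial.X i)) := by
      rcases i with i | i
      · rw [piMap_u, polyDeriv_u, map_zero, map_sum]
        simp only [map_smul, piMap_u, smul_zero, Finset.sum_const_zero]
      · rw [piMap_v, polyDeriv_v, commDeriv_comm, map_sum, Fin.sum_univ_castSucc]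
        simp only [h0, h1, zero_smul, zero_add, add_zero, map_smul, piMap_v,
          Matrix.submatrix_apply]
    rw [piMap_mul, map_add, commDeriv_smul, commDeriv_smul, hp, hX, polyDeriv_polyIncl h1,
      polyDeriv_polyIncl h1, Derivation.leibniz, map_add, smul_eq_mul, smul_eq_mul, piMap_mul,
      piMap_mul]
    abel

/-- The restriction of a linear derivation of `K[U, V]` to the ideal `K[U, V]_ω`. -/
def omegaDeriv (β : Matrix (Fin n) (Fin n) K) : omega K n →ₗ[K] omega K n :=
  (polyDeriv β).toLinearMap.restrict fun _ => polyDeriv_mem_omegaIdeal β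

theorem commDeriv_assemble (h0 : ∀ i, α i (Fin.last n) = 0)
    (h1 : ∀ j : Fin n, α (Fin.last n) j.castSucc = 0)
    (F : ℕ × ℕ →₀ commIdeal K (Fin n)) (G : ℕ × ℕ →₀ omega K n) :
    commDeriv α (assemble K n (F, G)) = assemble K n
      (Finsupp.mapRange.linearMap (commDeriv (α.submatrix Fin.castSucc Fin.castSucc)) F,
        Finsupp.mapRange.linearMap (omegaDeriv (α.submatrix Fin.castSucc Fin.castSucc)) G) := by
  rw [assemble_apply, assemble_apply, Finsupp.mapRange.linearMap_apply,
    Finsupp.mapRange.linearMap_apply, Finsupp.sum_mapRange_index (by simp),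
    Finsupp.sum_mapRange_index (by simp), map_add, map_finsuppSum, map_finsuppSum]
  simp only [commDeriv_lastMon_smul h0, commDeriv_commMap h1, commDeriv_piMap h0 h1]
  rfl

theorem assemble_mem_commConst [CharZero K] (h0 : ∀ i, α i (Fin.last n) = 0)
    (h1 : ∀ j : Fin n, α (Fin.last n) j.castSucc = 0)
    (F : ℕ × ℕ →₀ commIdeal K (Fin n)) (G : ℕ × ℕ →₀ omega K n) :
    assemble K n (F, G) ∈ commConst α ↔
      (∀ t, F t ∈ commConst (α.submatrix Fin.castSucc Fin.castSucc)) ∧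
        ∀ t, (G t).1 ∈ omegaConst (α.submatrix Fin.castSucc Fin.castSucc) := by
  have hG : ∀ t, (G t).1 ∈ omegaConst (α.submatrix Fin.castSucc Fin.castSucc) ↔
      omegaDeriv (α.submatrix Fin.castSucc Fin.castSucc) (G t) = 0 := fun t => by
    rw [← Submodule.coe_eq_zero]
    exact and_iff_right (G t).2
  simp only [mem_commConst, hG, commDeriv_assemble h0 h1]
  rw [map_eq_zero_iff _ assemble_injective, Prod.mk_eq_zero, Finsupp.ext_iff, Finsupp.ext_iff]
  rfl

/-! ### The constants -/

/-- The restriction of `assemble` to the constants of `δ`. -/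
def constAssemble [CharZero K] (h0 : ∀ i, α i (Fin.last n) = 0)
    (h1 : ∀ j : Fin n, α (Fin.last n) j.castSucc = 0) :
    ((ℕ × ℕ →₀ commConst (α.submatrix Fin.castSucc Fin.castSucc)) ×
      (ℕ × ℕ →₀ omegaConst (α.submatrix Fin.castSucc Fin.castSucc))) →ₗ[K] commConst α :=
  LinearMap.codRestrict _
    (assemble K n ∘ₗ LinearMap.prodMap
      (Finsupp.mapRange.linearMap (Submodule.subtype _))
      (Finsupp.mapRange.linearMap (Submodule.inclusion inf_le_left)))
    fun z => (assemble_mem_commConst h0 h1 _ _).2 ⟨fun t => (z.1 t).2, fun t => (z.2 t).2⟩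

theorem constAssemble_bijective [CharZero K] (h0 : ∀ i, α i (Fin.last n) = 0)
    (h1 : ∀ j : Fin n, α (Fin.last n) j.castSucc = 0) :
    Function.Bijective (constAssemble h0 h1) := by
  constructor
  · rintro ⟨F, G⟩ ⟨F', G'⟩ h
    have h2 := Prod.ext_iff.1 (assemble_injective (congrArg Subtype.val h))
    exact Prod.ext (Finsupp.mapRange_injective _ rfl Subtype.val_injective h2.1)
      (Finsupp.mapRange_injective _ rfl (Submodule.inclusion_injective _) h2.2)
  · rintro ⟨y, hy⟩
    obtain ⟨⟨F, G⟩, rfl⟩ := assemble_surjective y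
    obtain ⟨hF, hG⟩ := (assemble_mem_commConst h0 h1 F G).1 hy
    refine ⟨(Finsupp.onFinset F.support (fun t => ⟨F t, hF t⟩) fun t ht => ?_,
      Finsupp.onFinset G.support (fun t => ⟨(G t).1, hG t⟩) fun t ht => ?_), ?_⟩
    · rw [Finsupp.mem_support_iff]
      exact fun h => ht (Subtype.ext h)
    · rw [Finsupp.mem_support_iff]
      intro h
      refine ht (Subtype.ext ?_)
      change (G t).1 = 0
      rw [h, Submodule.coe_zero]
    · exact Subtype.ext (congrArg (assemble K n)
        (Prod.ext (Finsupp.ext fun t => rfl) (Finsupp.ext fun t => rfl)))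

theorem constAssemble_single_zero [CharZero K] (h0 : ∀ i, α i (Fin.last n) = 0)
    (h1 : ∀ j : Fin n, α (Fin.last n) j.castSucc = 0) (t : ℕ × ℕ)
    (f : commConst (α.submatrix Fin.castSucc Fin.castSucc)) :
    (constAssemble h0 h1 (Finsupp.single t f, 0)).1 =
      lastMon K n t • commMap Fin.castSucc f.1 := by
  have h : (constAssemble h0 h1 (Finsupp.single t f, 0)).1 =
      assemble K n (Finsupp.single t f.1, 0) :=
    congrArg (assemble K n) (Prod.ext
      (Finsupp.mapRange_single (hf := map_zero _)) (Finsupp.mapRange_zero (hf := map_zero _)))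
  rw [h, assemble_apply, Finsupp.sum_single_index (by simp), Finsupp.sum_zero_index, add_zero]

theorem constAssemble_zero_single [CharZero K] (h0 : ∀ i, α i (Fin.last n) = 0)
    (h1 : ∀ j : Fin n, α (Fin.last n) j.castSucc = 0) (t : ℕ × ℕ)
    (g : omegaConst (α.submatrix Fin.castSucc Fin.castSucc)) :
    (constAssemble h0 h1 (0, Finsupp.single t g)).1 = lastMon K n t • piMap K n g.1 := by
  have h : (constAssemble h0 h1 (0, Finsupp.single t g)).1 =
      assemble K n (0, Finsupp.single t (Submodule.inclusion inf_le_left g)) :=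
    congrArg (assemble K n) (Prod.ext
      (Finsupp.mapRange_zero (hf := map_zero _)) (Finsupp.mapRange_single (hf := map_zero _)))
  rw [h, assemble_apply, Finsupp.sum_single_index (by simp), Finsupp.sum_zero_index, zero_add]
  rfl

end FreeMetab

end

open FreeMetab in
theorem mainTheorem2 {K : Type*} [Field K] [CharZero K] (n : ℕ)
    (α : Matrix (Fin (n + 1)) (Fin (n + 1)) K)
    (hlast : linDeriv α (gen K (Fin.last n)) = 0)
    (hinv : ∀ j : Fin n, linDeriv α (gen K j.castSucc) ∈
      Submodule.span K (Set.range fun i : Fin n => gen K i.castSucc))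
    (hnil : IsNilpotent (α.submatrix Fin.castSucc Fin.castSucc))
    {I J : Type*}
    (d : Module.Basis I K (commConst (α.submatrix Fin.castSucc Fin.castSucc)))
    (g : Module.Basis J K (omegaConst (α.submatrix Fin.castSucc Fin.castSucc))) :
    ∃ b : Module.Basis ((I × ℕ × ℕ) ⊕ (J × ℕ × ℕ)) K (commConst α),
      (∀ i p q, (b (Sum.inl (i, p, q)) : commIdeal K (Fin (n + 1))) =
        (u K (Fin.last n) ^ p * v K (Fin.last n) ^ q) • commMap Fin.castSucc (d i).1) ∧
      (∀ j p q, (b (Sum.inr (j, p, q)) : commIdeal K (Fin (n + 1))) =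
        (u K (Fin.last n) ^ p * v K (Fin.last n) ^ q) • piMap K n (g j).1) := by
  have h0 := apply_last_eq_zero hlast
  have h1 := fun j => last_apply_eq_zero (hinv j)
  refine ⟨(((Finsupp.basis fun _ : ℕ × ℕ => d).prod (Finsupp.basis fun _ : ℕ × ℕ => g)).map
    (LinearEquiv.ofBijective _ (constAssemble_bijective h0 h1))).reindex
      (Equiv.sumCongr ((Equiv.sigmaEquivProd _ _).trans (Equiv.prodComm _ _))
        ((Equiv.sigmaEquivProd _ _).trans (Equiv.prodComm _ _))), fun i p q => ?_, fun j p q => ?_⟩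
  · rw [Module.Basis.reindex_apply, Module.Basis.map_apply]
    simpa [Module.Basis.prod_apply, lastMon] using constAssemble_single_zero h0 h1 (p, q) (d i)
  · rw [Module.Basis.reindex_apply, Module.Basis.map_apply]
    simpa [Module.Basis.prod_apply, lastMon] using constAssemble_zero_single h0 h1 (p, q) (g j)
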